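/- Let $N,n,m$ be natural numbers and consider the model $x_k=g_k(x_{k-1})+w_k$, $z_k=h_k(x_k)+v_k$, $k=1,\dots,N$, where $g_k:\mathbb R^n\to\mathbb R^n$ and $h_k:\mathbb R^n\to\mathbb R^m$ are twice continuously differentiable, $z_k\in\mathbb R^m$ is given, and $g_1(x_0):=g_0$ is a known constant. Let $Q_k\in\mathbb R^{n\times n}$, $R_k\in\mathbb R^{m\times m}$ be positive definite and $r_k,s_k>0$. Fix a set $\mathcal W^S\subseteq\{1,\dots,n\}$ of components of the process residuals and a set $\mathcal V^S\subseteq\{1,\dots,m\}$ of components of the measurement residuals (those modeled by Student's t distributions); the remaining components are modeled by Gaussian distributions. For $x=(x_1,\dots,x_N)\in\mathbb R^{nN}$ let $w_k=x_k-g_k(x_{k-1})$, $v_k=z_k-h_k(x_k)$, let $w_k^S,w_k^G,v_k^S,v_k^G$ be the corresponding subvectors and $Q_k^S,Q_k^G,R_k^S,R_k^G$ the corresponding diagonal submatrices of $Q_k$, $R_k$, and write $\|u\|_M^2=u^{T}Mu$. Set $$f(x)=\tfrac12\sum_{k=1}^N\Big(s_k\ln\big[1+\|v_k^S\|^2_{(R_k^S)^{-1}}/s_k\big]+r_k\ln\big[1+\|w_k^S\|^2_{(Q_k^S)^{-1}}/r_k\big]\Big),\qquad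 F(x)=\big(f(x),[w^G(x);v^G(x)]\big),$$ $$\rho(c,u)=c+\tfrac12\|u\|_{B^{-1}}^2+\delta_{\mathbb R_+}(c),\quad B=\mathrm{diag}(Q_1^G,\dots,Q_N^G,R_1^G,\dots,R_N^G),\qquad K=\rho\circ F,$$ where $\delta_{\mathbb R_+}(c)=0$ for $c\ge 0$ and $+\infty$ otherwise. Write $(g_k^{(1)})^S$ for the $\mathcal W^S\times\mathcal W^S$ submatrix of the Jacobian of $g_k$ at $x_{k-1}$ and $(h_k^{(1)})^S$ for the rows in $\mathcal V^S$ of the Jacobian of $h_k$ at $x_k$. Let $W_k=\frac{r_k(Q_k^S)^{-1}}{r_k+\|w_k^S\|^2_{(Q_k^S)^{-1}}}$, $A_k=-W_k(g_k^{(1)})^S$, $U_k=W_k+((g_{k+1}^{(1)})^S)^TW_{k+1}(g_{k+1}^{(1)})^S$ for $k<N$, $U_N=W_N$, and $H_k=\frac{s_k((h_k^{(1)})^S)^T(R_k^S)^{-1}(h_k^{(1)})^S}{s_k+\|v_k^S\|^2_{(R_k^S)^{-1}}}\in\mathbb R^{n\times n}$. Let $U(x)\in\mathbb R^{nN\times nN}$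 be the symmetric block tridiagonal matrix with diagonal blocks $U_k$ and subdiagonal blocks $A_k$, placed on the components in $\mathcal W^S$ and zero elsewhere, plus $\mathrm{diag}(\{H_k\})$. Let $G^S(x)$ be the lower block bidiagonal matrix with identity diagonal blocks and blocks $-(g_k^{(1)})^S$ in positions $(k,k-1)$, $k=2,\dots,N$. Fix $x^0\in\mathbb R^{nN}$ and put $\Lambda=\{u:\rho(u)\le K(x^0)\}$ and $S_0=\overline{\mathrm{co}}\,(F^{-1}(\Lambda))+\tau\mathbb B$ with $\mathbb B$ the closed unit ball. Then: 1. $\rho$ is convex, $F$ is twice continuously differentiable, $U$ is continuous and $U(x)$ is symmetric positive semidefinite for every $x$; and for every $\tau>0$ the derivative $F'$ is bounded and uniformly continuous on $S_0$. 2. If for every $x\in F^{-1}(\Lambda)$ there is $\eta$ with $0<\eta<\sigma_{\min}(G^S(x))$ (in particular, if $\sigma_{\min}(G^S(x))$ is bounded away from zero on $F^{-1}(\Lambda)$; the condition counts as satisfied when $G^S(x)$ is the $0\times0$ matrix), then $F^{-1}(\Lambda)$ is bounded and there is $\lambda_{\min}>0$ such that $$\lambda_{\min}\|d\|^2\le d^TU(x)d\qquad\text{for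 all }x\in F^{-1}(\Lambda)\text{ and all }d\text{ with }F'(x)d=0 .$$ 3. This covers the T-Robust, T-Trend and Double-T smoothers: $K(x)$ equals $\frac12\sum_k\big(s_k\ln[1+\|v_k\|^2_{R_k^{-1}}/s_k]+\|w_k\|^2_{Q_k^{-1}}\big)$ if $\mathcal W^S=\emptyset$, $\mathcal V^S=\{1,\dots,m\}$; $\frac12\sum_k\big(r_k\ln[1+\|w_k\|^2_{Q_k^{-1}}/r_k]+\|v_k\|^2_{R_k^{-1}}\big)$ if $\mathcal W^S=\{1,\dots,n\}$, $\mathcal V^S=\emptyset$; $\frac12\sum_k\big(r_k\ln[1+\|w_k\|^2_{Q_k^{-1}}/r_k]+s_k\ln[1+\|v_k\|^2_{R_k^{-1}}/s_k]\big)$ if $\mathcal W^S=\{1,\dots,n\}$, $\mathcal V^S=\{1,\dots,m\}$. -/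

import Mathlib

open Matrix Set
open scoped Pointwise

noncomputable section

/-- `ℝ^ι` with the Euclidean norm. -/
abbrev Euc (ι : Type) [Fintype ι] : Type := EuclideanSpace ℝ ι

/-- State sequences `x = vec {x_k}`, `x_k ∈ ℝⁿ`, `k = 1, …, N`. The time index `k` runs through
`Fin N` and so starts at `0`; the coordinate `(k, i)` is the `i`-th component of `x_k`. -/
abbrev StateSeq (N n : ℕ) : Type := Euc (Fin N × Fin n)

/-- `‖u‖_M² = uᵀ M u`. -/
def sqNorm {ι : Type} [Fintype ι] (M : Matrix ι ι ℝ) (u : ι → ℝ) : ℝ := u ⬝ᵥ (M *ᵥ u)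

/-- The Jacobian matrix of `φ` at `y`. -/
def jacobian {p q : ℕ} (φ : Euc (Fin p) → Euc (Fin q)) (y : Euc (Fin p)) :
    Matrix (Fin q) (Fin p) ℝ :=
  Matrix.of fun i j => fderiv ℝ φ y (EuclideanSpace.single j 1) i

/-- The smallest singular value of a square matrix. It is the infimum of the `card ι` singular
values, hence `⊤` for the `0 × 0` matrix. -/
def sigmaMin {ι : Type} [Fintype ι] [DecidableEq ι] (A : Matrix ι ι ℝ) : EReal :=
  ⨅ i : Fin (Fintype.card ι), (((Matrix.toEuclideanLin A).singularValues i : ℝ) : EReal)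

section ConvexComposite

variable {X Y : Type} [NormedAddCommGroup X] [NormedSpace ℝ X]

/-- The composite objective `K = ρ ∘ F`. -/
def compositeObjective (ρ : Y → EReal) (F : X → Y) (x : X) : EReal := ρ (F x)

/-- The level set `Λ = {u | ρ u ≤ K x⁰}`. -/
def levelSet (ρ : Y → EReal) (F : X → Y) (x0 : X) : Set Y :=
  {u | ρ u ≤ compositeObjective ρ F x0}

/-- `S₀ = cl co (F⁻¹ Λ) + τ 𝔹`, where `𝔹` is the closed unit ball. -/
def enlargedHull (ρ : Y → EReal) (F : X → Y) (x0 : X) (τ : ℝ) : Set X :=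
  closure (convexHull ℝ (F ⁻¹' levelSet ρ F x0)) + τ • Metric.closedBall (0 : X) 1

end ConvexComposite

/-- The data of the smoothing framework with Student's t and Gaussian residuals:
`x_k = g_k (x_{k-1}) + w_k` (with `x_1 = g0 + w_1`) and `z_k = h_k (x_k) + v_k`, for
`k = 1, …, N`. The map `g k` is used for all `k` but the first. `WS` and `VS` are the components
of the process and measurement residuals that follow Student's t distributions, the other
components being Gaussian. `Q k` and `R k` are the covariance matrices, `r k` and `s k` the degrees
of freedom. -/
structure Smoother (N n m : ℕ) where
  g0 : Euc (Fin n)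
  g : Fin N → Euc (Fin n) → Euc (Fin n)
  h : Fin N → Euc (Fin n) → Euc (Fin m)
  z : Fin N → Euc (Fin m)
  WS : Finset (Fin n)
  VS : Finset (Fin m)
  Q : Fin N → Matrix (Fin n) (Fin n) ℝ
  R : Fin N → Matrix (Fin m) (Fin m) ℝ
  r : Fin N → ℝ
  s : Fin N → ℝ
  Q_posDef : ∀ k, (Q k).PosDef
  R_posDef : ∀ k, (R k).PosDef
  r_pos : ∀ k, 0 < r k
  s_pos : ∀ k, 0 < s k

namespace Smoother

variable {N n m : ℕ} (M : Smoother N n m)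

/-- The block `x_k` of a state sequence. -/
def block (x : StateSeq N n) (k : Fin N) : Euc (Fin n) :=
  WithLp.toLp 2 fun i => x (k, i)

/-- The predicted state `g_k (x_{k-1})`, which is the constant `g0` at the first time. -/
def predicted (x : StateSeq N n) (k : Fin N) : Euc (Fin n) :=
  if k.val = 0 then M.g0
  else M.g k (block x ⟨k.val - 1, lt_of_le_of_lt (Nat.sub_le _ _) k.isLt⟩)

/-- The process residual `w_k = x_k - g_k (x_{k-1})`. -/
def w (x : StateSeq N n) (k : Fin N) : Euc (Fin n) := block x k - M.predicted x k

/-- The measurement residual `v_k = z_k - h_k (x_k)`. -/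
def v (x : StateSeq N n) (k : Fin N) : Euc (Fin m) := M.z k - M.h k (block x k)

/-! Student's t and Gaussian subvectors of the residuals, with their covariance matrices. -/

def wS (x : StateSeq N n) (k : Fin N) : {i // i ∈ M.WS} → ℝ := fun i => M.w x k i
def wG (x : StateSeq N n) (k : Fin N) : {i // i ∉ M.WS} → ℝ := fun i => M.w x k i
def vS (x : StateSeq N n) (k : Fin N) : {i // i ∈ M.VS} → ℝ := fun i => M.v x k i
def vG (x : StateSeq N n) (k : Fin N) : {i // i ∉ M.VS} → ℝ := fun i => M.v x k i

def QS (k : Fin N) : Matrix {i // i ∈ M.WS} {i // i ∈ M.WS} ℝ :=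
  (M.Q k).submatrix Subtype.val Subtype.val
def QG (k : Fin N) : Matrix {i // i ∉ M.WS} {i // i ∉ M.WS} ℝ :=
  (M.Q k).submatrix Subtype.val Subtype.val
def RS (k : Fin N) : Matrix {i // i ∈ M.VS} {i // i ∈ M.VS} ℝ :=
  (M.R k).submatrix Subtype.val Subtype.val
def RG (k : Fin N) : Matrix {i // i ∉ M.VS} {i // i ∉ M.VS} ℝ :=
  (M.R k).submatrix Subtype.val Subtype.val

/-- The Student's t part `f` of the objective. -/
def f (x : StateSeq N n) : ℝ :=
  1 / 2 * ∑ k, (M.s k * Real.log (1 + sqNorm (M.RS k)⁻¹ (M.vS x k) / M.s k)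
    + M.r k * Real.log (1 + sqNorm (M.QS k)⁻¹ (M.wS x k) / M.r k))

/-- Index set of the stacked Gaussian residuals `[w^G; v^G]`. -/
abbrev GaussIdx : Type :=
  (Fin N × {i // i ∉ M.WS}) ⊕ (Fin N × {i // i ∉ M.VS})

/-- The range space of `F`: pairs `(c, u)`. -/
abbrev Target : Type := ℝ × Euc M.GaussIdx

/-- `F x = (f x, [w^G x; v^G x])`. -/
def F (x : StateSeq N n) : M.Target :=
  (M.f x, WithLp.toLp 2 (Sum.elim (fun p => M.wG x p.1 p.2) (fun p => M.vG x p.1 p.2)))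

/-- `‖u‖²_{B⁻¹}` for `B` the block diagonal matrix with the blocks
`Q_1^G, …, Q_N^G, R_1^G, …, R_N^G`. -/
def gaussSq (u : Euc M.GaussIdx) : ℝ :=
  ∑ k, sqNorm (M.QG k)⁻¹ (fun i => u (Sum.inl (k, i)))
    + ∑ k, sqNorm (M.RG k)⁻¹ (fun i => u (Sum.inr (k, i)))

/-- `ρ (c, u) = c + ½ ‖u‖²_{B⁻¹} + δ_{ℝ₊}(c)`. -/
def rho (p : M.Target) : EReal :=
  ((p.1 + 1 / 2 * M.gaussSq p.2 : ℝ) : EReal) + (if 0 ≤ p.1 then 0 else ⊤)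

/-- `(g_k^{(1)}(y))^S`, the square submatrix of the Jacobian of `g_k` with indices in `WS`. -/
def gJacS (k : Fin N) (y : Euc (Fin n)) : Matrix {i // i ∈ M.WS} {i // i ∈ M.WS} ℝ :=
  (jacobian (M.g k) y).submatrix Subtype.val Subtype.val

/-- `(h_k^{(1)}(y))^S`, the rows with index in `VS` of the Jacobian of `h_k`. -/
def hJacS (k : Fin N) (y : Euc (Fin n)) : Matrix {i // i ∈ M.VS} (Fin n) ℝ :=
  (jacobian (M.h k) y).submatrix Subtype.val id

/-- The lower block bidiagonal matrix `G^S x`, with identities as diagonal blocks and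
`-(g_k^{(1)}(x_{k-1}))^S` as the block in position `(k, k-1)`. -/
def GS (x : StateSeq N n) :
    Matrix (Fin N × {i // i ∈ M.WS}) (Fin N × {i // i ∈ M.WS}) ℝ :=
  Matrix.of fun p q =>
    if p.1 = q.1 then (1 : Matrix {i // i ∈ M.WS} {i // i ∈ M.WS} ℝ) p.2 q.2
    else if p.1.val = q.1.val + 1 then -(M.gJacS p.1 (block x q.1) p.2 q.2)
    else 0

/-- `r_k (Q_k^S)⁻¹ / (r_k + ‖w_k^S‖²)`, the norm being that of `(Q_k^S)⁻¹`. -/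
def weightW (x : StateSeq N n) (k : Fin N) : Matrix {i // i ∈ M.WS} {i // i ∈ M.WS} ℝ :=
  (M.r k / (M.r k + sqNorm (M.QS k)⁻¹ (M.wS x k))) • (M.QS k)⁻¹

/-- `s_k (R_k^S)⁻¹ / (s_k + ‖v_k^S‖²)`, the norm being that of `(R_k^S)⁻¹`. -/
def weightV (x : StateSeq N n) (k : Fin N) : Matrix {i // i ∈ M.VS} {i // i ∈ M.VS} ℝ :=
  (M.s k / (M.s k + sqNorm (M.RS k)⁻¹ (M.vS x k))) • (M.RS k)⁻¹

/-- The subdiagonal block `A_k` of the curvature matrix; `l` is the time before `k`. -/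
def Ablk (x : StateSeq N n) (k l : Fin N) : Matrix {i // i ∈ M.WS} {i // i ∈ M.WS} ℝ :=
  -(M.weightW x k * M.gJacS k (block x l))

/-- The diagonal block `U_k` of the curvature matrix, where `g_{N+1} = 0`. -/
def Ublk (x : StateSeq N n) (k : Fin N) : Matrix {i // i ∈ M.WS} {i // i ∈ M.WS} ℝ :=
  (if hk : k.val + 1 < N then
    (M.gJacS ⟨k.val + 1, hk⟩ (block x k))ᵀ * M.weightW x ⟨k.val + 1, hk⟩
      * M.gJacS ⟨k.val + 1, hk⟩ (block x k)
  else 0) + M.weightW x k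

/-- The measurement term `H_k` (Student's t part) of the curvature matrix. -/
def Hblk (x : StateSeq N n) (k : Fin N) : Matrix (Fin n) (Fin n) ℝ :=
  (M.hJacS k (block x k))ᵀ * M.weightV x k * M.hJacS k (block x k)

/-- The block in position `(k, l)` of the block tridiagonal matrix with diagonal blocks `U_k`,
subdiagonal blocks `A_k` and superdiagonal blocks `A_kᵀ`. -/
def triBlk (x : StateSeq N n) (k l : Fin N) : Matrix {i // i ∈ M.WS} {i // i ∈ M.WS} ℝ :=
  if k = l then M.Ublk x k
  else if k.val = l.val + 1 then M.Ablk x k l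
  else if l.val = k.val + 1 then (M.Ablk x l k)ᵀ
  else 0

/-- The curvature matrix `U x`: the block tridiagonal matrix above, placed on the components in
`WS` and zero on the others, plus `diag {H_k}`. -/
def U (x : StateSeq N n) : Matrix (Fin N × Fin n) (Fin N × Fin n) ℝ :=
  Matrix.of fun p q =>
    (if hpq : p.2 ∈ M.WS ∧ q.2 ∈ M.WS then M.triBlk x p.1 q.1 ⟨p.2, hpq.1⟩ ⟨q.2, hpq.2⟩ else 0)
      + (if p.1 = q.1 then M.Hblk x p.1 p.2 q.2 else 0)

/-- The objective `K = ρ ∘ F`. -/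
def K : StateSeq N n → EReal := compositeObjective M.rho M.F

/-- The level set `Λ` for the initial point `x0`. -/
def Lam (x0 : StateSeq N n) : Set M.Target := levelSet M.rho M.F x0

/-- The set `S₀` for the initial point `x0`. -/
def S0 (x0 : StateSeq N n) (τ : ℝ) : Set (StateSeq N n) := enlargedHull M.rho M.F x0 τ

/-- T-Robust: Student's t measurement residuals, Gaussian process residuals. -/
def IsTRobust : Prop := M.WS = ∅ ∧ M.VS = Finset.univ

/-- T-Trend: Student's t process residuals, Gaussian measurement residuals. -/
def IsTTrend : Prop := M.WS = Finset.univ ∧ M.VS = ∅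

/-- Double-T: Student's t process and measurement residuals. -/
def IsDoubleT : Prop := M.WS = Finset.univ ∧ M.VS = Finset.univ

/-- The objective of the T-Robust smoother. -/
def objTRobust (x : StateSeq N n) : ℝ :=
  1 / 2 * ∑ k, (M.s k * Real.log (1 + sqNorm (M.R k)⁻¹ (M.v x k) / M.s k)
    + sqNorm (M.Q k)⁻¹ (M.w x k))

/-- The objective of the T-Trend smoother. -/
def objTTrend (x : StateSeq N n) : ℝ :=
  1 / 2 * ∑ k, (M.r k * Real.log (1 + sqNorm (M.Q k)⁻¹ (M.w x k) / M.r k)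
    + sqNorm (M.R k)⁻¹ (M.v x k))

/-- The objective of the Double-T smoother. -/
def objDoubleT (x : StateSeq N n) : ℝ :=
  1 / 2 * ∑ k, (M.r k * Real.log (1 + sqNorm (M.Q k)⁻¹ (M.w x k) / M.r k)
    + M.s k * Real.log (1 + sqNorm (M.R k)⁻¹ (M.v x k) / M.s k))

end Smoother

end

/-! Two facts carry the theorem.

Compactness. Since `f ≥ 0`, the indicator in `ρ` never acts along `F`, and a bound on `K` bounds
every process residual: the Gaussian components directly, the Student's t components by inverting
the logarithm. As `x_k = w_k + g_k (x_{k-1})` and each `g_k` is bounded on balls, the bound passes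
forward in time to all states (`exists_norm_block_le`). So `F⁻¹ Λ` and `S₀` are compact, and the
continuous map `F'` is bounded and uniformly continuous on `S₀`.

Positivity. `U` is a sum of terms `Tᵀ W T` with `W` positive definite (`U_eq_sum`), hence
semidefinite, and `dᵀ U d = 0` forces `G^S d^S = 0`. If also `F' d = 0`, the Gaussian process
residuals have zero derivative along `d`. Both systems are triangular in time with identity
diagonal: once `d_{k-1} = 0`, one gives `d_k^S = 0` and the other `d_k^G = 0`. So `d = 0`
(`eq_zero_of_sqNorm_U_eq_zero`), and compactness turns strict positivity on the kernels into a
uniform `λ_min`. -/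

noncomputable section

/-! ### Quadratic forms -/

section sqNorm

variable {ι κ : Type} [Fintype ι] [Fintype κ]

lemma sqNorm_nonneg {A : Matrix ι ι ℝ} (hA : A.PosSemidef) (u : ι → ℝ) : 0 ≤ sqNorm A u := by
  simpa [sqNorm] using hA.dotProduct_mulVec_nonneg u

lemma sqNorm_pos {A : Matrix ι ι ℝ} (hA : A.PosDef) {u : ι → ℝ} (hu : u ≠ 0) :
    0 < sqNorm A u := by
  simpa [sqNorm] using hA.dotProduct_mulVec_pos hu

lemma sqNorm_eq_sum (A : Matrix ι ι ℝ) (u : ι → ℝ) :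
    sqNorm A u = ∑ i, u i * ∑ j, A i j * u j := rfl

lemma sqNorm_smul_vec (A : Matrix ι ι ℝ) (c : ℝ) (u : ι → ℝ) :
    sqNorm A (c • u) = c ^ 2 * sqNorm A u := by
  simp only [sqNorm, mulVec_smul, dotProduct_smul, smul_dotProduct, smul_eq_mul]
  ring

lemma sqNorm_transpose_mul_mul (A : Matrix ι ι ℝ) (T : Matrix ι κ ℝ) (u : κ → ℝ) :
    sqNorm (Tᵀ * A * T) u = sqNorm A (T *ᵥ u) := by
  rw [sqNorm, sqNorm, Matrix.mul_assoc, ← mulVec_mulVec, ← mulVec_mulVec, dotProduct_mulVec,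
    vecMul_transpose]

lemma sqNorm_add (A B : Matrix ι ι ℝ) (u : ι → ℝ) :
    sqNorm (A + B) u = sqNorm A u + sqNorm B u := by
  simp [sqNorm, add_mulVec, dotProduct_add]

lemma sqNorm_sum {α : Type*} (s : Finset α) (A : α → Matrix ι ι ℝ) (u : ι → ℝ) :
    sqNorm (∑ k ∈ s, A k) u = ∑ k ∈ s, sqNorm (A k) u := by
  simp [sqNorm, sum_mulVec, dotProduct_sum]

lemma sqNorm_submatrix_equiv (e : ι ≃ κ) (A : Matrix κ κ ℝ) (u : κ → ℝ) :
    sqNorm (A.submatrix e e) (u ∘ e) = sqNorm A u := by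
  simp only [sqNorm_eq_sum, submatrix_apply, Function.comp]
  rw [← e.sum_comp]
  exact Finset.sum_congr rfl fun i _ => by rw [← e.sum_comp]

lemma sqNorm_of_isEmpty [IsEmpty ι] (A : Matrix ι ι ℝ) (u : ι → ℝ) : sqNorm A u = 0 := by
  simp [sqNorm_eq_sum]

lemma contDiff_sqNorm {E : Type*} [NormedAddCommGroup E] [NormedSpace ℝ E] {p : WithTop ℕ∞}
    (A : Matrix ι ι ℝ) {u : E → ι → ℝ} (hu : ∀ i, ContDiff ℝ p fun x => u x i) :
    ContDiff ℝ p fun x => sqNorm A (u x) := by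
  simp only [sqNorm_eq_sum]
  exact ContDiff.sum fun i _ => (hu i).mul (ContDiff.sum fun j _ => contDiff_const.mul (hu j))

lemma continuous_sqNorm {E : Type*} [TopologicalSpace E] {A : E → Matrix ι ι ℝ} {u : E → ι → ℝ}
    (hA : Continuous A) (hu : Continuous u) : Continuous fun x => sqNorm (A x) (u x) :=
  hu.dotProduct (hA.matrix_mulVec hu)

/-- The convexity defect is exactly `a b ‖u - v‖²_A`. -/
lemma convexOn_sqNorm {A : Matrix ι ι ℝ} (hA : A.PosSemidef) :
    ConvexOn ℝ univ (sqNorm A) := by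
  refine ⟨convex_univ, fun u _ v _ a b ha hb hab => ?_⟩
  have key : a * sqNorm A u + b * sqNorm A v - sqNorm A (a • u + b • v)
      = a * b * sqNorm A (u - v) := by
    obtain rfl : b = 1 - a := by linarith
    simp only [sqNorm, mulVec_add, mulVec_sub, mulVec_smul, dotProduct_add, add_dotProduct,
      dotProduct_sub, sub_dotProduct, dotProduct_smul, smul_dotProduct, smul_eq_mul]
    ring
  have := mul_nonneg (mul_nonneg ha hb) (sqNorm_nonneg hA (u - v))
  simp only [smul_eq_mul]
  linarith

/-- The constant is the minimum of the form on the unit sphere of the sup norm, extended by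
homogeneity. -/
lemma exists_pos_mul_sq_norm_le_sqNorm {A : Matrix ι ι ℝ} (hA : A.PosDef) :
    ∃ c : ℝ, 0 < c ∧ ∀ u : ι → ℝ, c * ‖u‖ ^ 2 ≤ sqNorm A u := by
  have hcont : Continuous (sqNorm A) := continuous_sqNorm continuous_const continuous_id
  rcases (Metric.sphere (0 : ι → ℝ) 1).eq_empty_or_nonempty with h | h
  -- The sphere is empty only in the zero space, where any constant works.
  · refine ⟨1, one_pos, fun u => ?_⟩
    have hu : u = 0 := by
      by_contra hu
      have : ‖u‖⁻¹ • u ∈ Metric.sphere (0 : ι → ℝ) 1 := by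
        simp [norm_smul, norm_ne_zero_iff.mpr hu]
      simp [h] at this
    simp [hu, sqNorm]
  · obtain ⟨v, hv, hmin⟩ := (isCompact_sphere (0 : ι → ℝ) 1).exists_isMinOn h hcont.continuousOn
    have hv0 : v ≠ 0 := by rintro rfl; simp at hv
    refine ⟨sqNorm A v, sqNorm_pos hA hv0, fun u => ?_⟩
    by_cases hu : u = 0
    · simp [hu, sqNorm]
    have hn : ‖u‖ ≠ 0 := norm_ne_zero_iff.mpr hu
    have h1 : sqNorm A v ≤ sqNorm A (‖u‖⁻¹ • u) :=
      hmin (show ‖u‖⁻¹ • u ∈ Metric.sphere (0 : ι → ℝ) 1 by simp [norm_smul, hn])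
    rw [sqNorm_smul_vec] at h1
    calc sqNorm A v * ‖u‖ ^ 2 ≤ (‖u‖⁻¹ ^ 2 * sqNorm A u) * ‖u‖ ^ 2 := by gcongr
      _ = sqNorm A u := by field_simp

end sqNorm

/-- The Student's t penalty grows slowly but without bound, so its sublevel sets are still bounded.
-/
lemma le_of_mul_log_one_add_div_le {a s C : ℝ} (ha : 0 ≤ a) (hs : 0 < s)
    (h : s * Real.log (1 + a / s) ≤ C) : a ≤ s * Real.exp (C / s) := by
  have h1 : Real.log (1 + a / s) ≤ C / s := by rwa [le_div_iff₀ hs, mul_comm]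
  have h2 : 1 + a / s ≤ Real.exp (C / s) := by
    rwa [← Real.log_le_iff_le_exp (by positivity)]
  have h3 : a / s ≤ Real.exp (C / s) := by linarith
  rwa [div_le_iff₀ hs, mul_comm] at h3

lemma mul_log_one_add_div_nonneg {a s : ℝ} (ha : 0 ≤ a) (hs : 0 < s) :
    0 ≤ s * Real.log (1 + a / s) :=
  mul_nonneg hs.le (Real.log_nonneg (by have := div_nonneg ha hs.le; linarith))

/-! ### Finiteness of `K` and convexity of `ρ` -/

namespace Smoother

variable {N n m : ℕ} (M : Smoother N n m)

lemma QS_posDef (k : Fin N) : (M.QS k).PosDef := (M.Q_posDef k).submatrix Subtype.val_injective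
lemma QG_posDef (k : Fin N) : (M.QG k).PosDef := (M.Q_posDef k).submatrix Subtype.val_injective
lemma RS_posDef (k : Fin N) : (M.RS k).PosDef := (M.R_posDef k).submatrix Subtype.val_injective
lemma RG_posDef (k : Fin N) : (M.RG k).PosDef := (M.R_posDef k).submatrix Subtype.val_injective

lemma sqNorm_wS_nonneg (x : StateSeq N n) (k : Fin N) : 0 ≤ sqNorm (M.QS k)⁻¹ (M.wS x k) :=
  sqNorm_nonneg (M.QS_posDef k).inv.posSemidef _

lemma sqNorm_vS_nonneg (x : StateSeq N n) (k : Fin N) : 0 ≤ sqNorm (M.RS k)⁻¹ (M.vS x k) :=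
  sqNorm_nonneg (M.RS_posDef k).inv.posSemidef _

lemma f_nonneg (x : StateSeq N n) : 0 ≤ M.f x :=
  mul_nonneg (by norm_num) (Finset.sum_nonneg fun k _ => add_nonneg
    (mul_log_one_add_div_nonneg (M.sqNorm_vS_nonneg x k) (M.s_pos k))
    (mul_log_one_add_div_nonneg (M.sqNorm_wS_nonneg x k) (M.r_pos k)))

lemma gaussSq_nonneg (u : Euc M.GaussIdx) : 0 ≤ M.gaussSq u :=
  add_nonneg (Finset.sum_nonneg fun k _ => sqNorm_nonneg (M.QG_posDef k).inv.posSemidef _)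
    (Finset.sum_nonneg fun k _ => sqNorm_nonneg (M.RG_posDef k).inv.posSemidef _)

lemma rho_of_nonneg {p : M.Target} (hp : 0 ≤ p.1) :
    M.rho p = ((p.1 + 1 / 2 * M.gaussSq p.2 : ℝ) : EReal) := by
  simp [rho, hp]

lemma rho_of_neg {p : M.Target} (hp : p.1 < 0) : M.rho p = ⊤ := by
  simp only [rho, not_le.mpr hp, if_false]
  exact EReal.coe_add_top _

/-- A finite level excludes the value `⊤`, so the epigraph is cut out by two real inequalities, both
convex. -/
lemma rho_le_coe_iff (p : M.Target) (c : ℝ) :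
    M.rho p ≤ (c : EReal) ↔ 0 ≤ p.1 ∧ p.1 + 1 / 2 * M.gaussSq p.2 ≤ c := by
  rcases le_or_gt 0 p.1 with hp | hp
  · rw [M.rho_of_nonneg hp, EReal.coe_le_coe_iff]
    simp [hp]
  · rw [M.rho_of_neg hp]
    simp [not_le.mpr hp]

lemma K_eq (x : StateSeq N n) :
    M.K x = ((M.f x + 1 / 2 * M.gaussSq (M.F x).2 : ℝ) : EReal) :=
  M.rho_of_nonneg (p := M.F x) (M.f_nonneg x)

lemma convexOn_gaussSq : ConvexOn ℝ univ M.gaussSq := by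
  refine ⟨convex_univ, fun u _ v _ a b ha hb hab => ?_⟩
  simp only [gaussSq, smul_eq_mul, mul_add, Finset.mul_sum]
  rw [add_add_add_comm]
  refine add_le_add (α := ℝ) ?_ ?_ <;> rw [← Finset.sum_add_distrib] <;>
    refine Finset.sum_le_sum fun k _ => ?_
  · exact (convexOn_sqNorm (M.QG_posDef k).inv.posSemidef).2 (mem_univ _) (mem_univ _) ha hb hab
  · exact (convexOn_sqNorm (M.RG_posDef k).inv.posSemidef).2 (mem_univ _) (mem_univ _) ha hb hab

lemma convex_epigraph_rho : Convex ℝ {p : M.Target × ℝ | M.rho p.1 ≤ (p.2 : EReal)} := by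
  intro p hp q hq a b ha hb hab
  simp only [mem_ofPred_eq, rho_le_coe_iff] at hp hq ⊢
  have h := M.convexOn_gaussSq.2 (mem_univ p.1.2) (mem_univ q.1.2) ha hb hab
  simp only [Prod.fst_add, Prod.snd_add, Prod.smul_fst, Prod.smul_snd, smul_eq_mul] at h ⊢
  constructor
  · exact add_nonneg (mul_nonneg ha hp.1) (mul_nonneg hb hq.1)
  · have h1 := mul_le_mul_of_nonneg_left hp.2 ha
    have h2 := mul_le_mul_of_nonneg_left hq.2 hb
    linarith

/-! ### Smoothness of `F` and continuity of `U` -/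

section Smooth

/-- The block `x_k` as a continuous linear function of the state sequence. -/
def blockL (k : Fin N) : StateSeq N n →L[ℝ] Euc (Fin n) :=
  LinearMap.toContinuousLinearMap
    { toFun := fun x => block x k
      map_add' := fun _ _ => rfl
      map_smul' := fun _ _ => rfl }

@[simp] lemma blockL_apply (k : Fin N) (x : StateSeq N n) : blockL k x = block x k := rfl

lemma contDiff_block {p : WithTop ℕ∞} (k : Fin N) :
    ContDiff ℝ p fun x : StateSeq N n => block x k := (blockL k).contDiff

lemma continuous_block (k : Fin N) : Continuous fun x : StateSeq N n => block x k :=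
  (blockL k).continuous

variable {M}

lemma contDiff_w (hg : ∀ k, ContDiff ℝ 2 (M.g k)) (k : Fin N) :
    ContDiff ℝ 2 fun x => M.w x k := by
  unfold w predicted
  split_ifs
  · exact (contDiff_block k).sub contDiff_const
  · exact (contDiff_block k).sub ((hg k).comp (contDiff_block _))

lemma contDiff_v (hh : ∀ k, ContDiff ℝ 2 (M.h k)) (k : Fin N) :
    ContDiff ℝ 2 fun x => M.v x k :=
  contDiff_const.sub ((hh k).comp (contDiff_block k))

lemma contDiff_sqNorm_wS (hg : ∀ k, ContDiff ℝ 2 (M.g k)) (k : Fin N) :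
    ContDiff ℝ 2 fun x => sqNorm (M.QS k)⁻¹ (M.wS x k) :=
  contDiff_sqNorm _ fun i => contDiff_euclidean.mp (contDiff_w hg k) i.1

lemma contDiff_sqNorm_vS (hh : ∀ k, ContDiff ℝ 2 (M.h k)) (k : Fin N) :
    ContDiff ℝ 2 fun x => sqNorm (M.RS k)⁻¹ (M.vS x k) :=
  contDiff_sqNorm _ fun i => contDiff_euclidean.mp (contDiff_v hh k) i.1

lemma contDiff_f (hg : ∀ k, ContDiff ℝ 2 (M.g k)) (hh : ∀ k, ContDiff ℝ 2 (M.h k)) :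
    ContDiff ℝ 2 M.f := by
  refine contDiff_const.mul (ContDiff.sum fun k _ => ContDiff.add ?_ ?_)
  · refine contDiff_const.mul (ContDiff.log (contDiff_const.add
      ((contDiff_sqNorm_vS hh k).div_const _)) ?_)
    intro x
    have := div_nonneg (M.sqNorm_vS_nonneg x k) (M.s_pos k).le
    positivity
  · refine contDiff_const.mul (ContDiff.log (contDiff_const.add
      ((contDiff_sqNorm_wS hg k).div_const _)) ?_)
    intro x
    have := div_nonneg (M.sqNorm_wS_nonneg x k) (M.r_pos k).le
    positivity

lemma contDiff_F (hg : ∀ k, ContDiff ℝ 2 (M.g k)) (hh : ∀ k, ContDiff ℝ 2 (M.h k)) :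
    ContDiff ℝ 2 M.F := by
  refine (contDiff_f hg hh).prodMk (contDiff_euclidean.mpr ?_)
  rintro (p | p)
  · exact contDiff_euclidean.mp (contDiff_w hg p.1) p.2
  · exact contDiff_euclidean.mp (contDiff_v hh p.1) p.2

lemma continuous_jacobian {p q : ℕ} {φ : Euc (Fin p) → Euc (Fin q)} (hφ : ContDiff ℝ 2 φ) :
    Continuous (jacobian φ) := by
  refine continuous_matrix fun i j => ?_
  have h : Continuous fun y => fderiv ℝ φ y (EuclideanSpace.single j 1) :=
    (hφ.continuous_fderiv (by norm_num)).clm_apply continuous_const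
  exact (EuclideanSpace.proj (𝕜 := ℝ) i).continuous.comp h

lemma continuous_gJacS (hg : ∀ k, ContDiff ℝ 2 (M.g k)) (k l : Fin N) :
    Continuous fun x : StateSeq N n => M.gJacS k (block x l) :=
  ((continuous_jacobian (hg k)).comp (continuous_block l)).matrix_submatrix _ _

lemma continuous_hJacS (hh : ∀ k, ContDiff ℝ 2 (M.h k)) (k l : Fin N) :
    Continuous fun x : StateSeq N n => M.hJacS k (block x l) :=
  ((continuous_jacobian (hh k)).comp (continuous_block l)).matrix_submatrix _ _

lemma continuous_weightW (hg : ∀ k, ContDiff ℝ 2 (M.g k)) (k : Fin N) :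
    Continuous fun x => M.weightW x k := by
  refine Continuous.smul (continuous_const.div (continuous_const.add
    (contDiff_sqNorm_wS hg k).continuous) fun x => ?_) continuous_const
  exact (add_pos_of_pos_of_nonneg (M.r_pos k) (M.sqNorm_wS_nonneg x k)).ne'

lemma continuous_weightV (hh : ∀ k, ContDiff ℝ 2 (M.h k)) (k : Fin N) :
    Continuous fun x => M.weightV x k := by
  refine Continuous.smul (continuous_const.div (continuous_const.add
    (contDiff_sqNorm_vS hh k).continuous) fun x => ?_) continuous_const
  exact (add_pos_of_pos_of_nonneg (M.s_pos k) (M.sqNorm_vS_nonneg x k)).ne'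

lemma continuous_triBlk (hg : ∀ k, ContDiff ℝ 2 (M.g k)) (k l : Fin N) :
    Continuous fun x => M.triBlk x k l := by
  have hA : ∀ k l, Continuous fun x => M.Ablk x k l := fun k l =>
    ((continuous_weightW hg k).matrix_mul (continuous_gJacS hg k l)).neg
  unfold triBlk
  split_ifs with h1 h2 h3
  · unfold Ublk
    split_ifs with hk
    · exact (((continuous_gJacS hg _ k).matrix_transpose.matrix_mul
        (continuous_weightW hg _)).matrix_mul (continuous_gJacS hg _ k)).add
        (continuous_weightW hg k)
    · exact continuous_const.add (continuous_weightW hg k)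
  · exact hA k l
  · exact (hA l k).matrix_transpose
  · exact continuous_const

lemma continuous_U (hg : ∀ k, ContDiff ℝ 2 (M.g k)) (hh : ∀ k, ContDiff ℝ 2 (M.h k)) :
    Continuous M.U := by
  refine continuous_matrix fun p q => Continuous.add ?_ ?_
  · split_ifs with h
    · exact (continuous_triBlk hg p.1 q.1).matrix_elem _ _
    · exact continuous_const
  · split_ifs with h
    · exact (((continuous_hJacS hh p.1 p.1).matrix_transpose.matrix_mul
        (continuous_weightV hh p.1)).matrix_mul (continuous_hJacS hh p.1 p.1)).matrix_elem _ _
    · exact continuous_const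

end Smooth

end Smoother

namespace Smoother

variable {N n m : ℕ} (M : Smoother N n m)

/-! ### Factorization of the curvature matrix -/

section Curvature

lemma weightW_posDef (x : StateSeq N n) (k : Fin N) : (M.weightW x k).PosDef :=
  (M.QS_posDef k).inv.smul
    (div_pos (M.r_pos k) (add_pos_of_pos_of_nonneg (M.r_pos k) (M.sqNorm_wS_nonneg x k)))

lemma weightV_posDef (x : StateSeq N n) (k : Fin N) : (M.weightV x k).PosDef :=
  (M.RS_posDef k).inv.smul
    (div_pos (M.s_pos k) (add_pos_of_pos_of_nonneg (M.s_pos k) (M.sqNorm_vS_nonneg x k)))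

lemma weightW_transpose (x : StateSeq N n) (k : Fin N) : (M.weightW x k)ᵀ = M.weightW x k := by
  simpa [IsHermitian] using (M.weightW_posDef x k).isHermitian

/-- The block in position `(k, l)` of `G^S x`. -/
def GSblk (x : StateSeq N n) (k l : Fin N) : Matrix {i // i ∈ M.WS} {i // i ∈ M.WS} ℝ :=
  if k = l then 1 else if k.val = l.val + 1 then -M.gJacS k (block x l) else 0

lemma GSblk_self (x : StateSeq N n) (k : Fin N) : M.GSblk x k k = 1 := by simp [GSblk]

lemma GSblk_succ (x : StateSeq N n) {k l : Fin N} (h : k.val = l.val + 1) :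
    M.GSblk x k l = -M.gJacS k (block x l) := by
  have : k ≠ l := by rintro rfl; omega
  simp [GSblk, h, this]

lemma GSblk_eq_zero (x : StateSeq N n) {k l : Fin N} (h : k ≠ l) (h' : k.val ≠ l.val + 1) :
    M.GSblk x k l = 0 := by
  simp [GSblk, h, h']

/-- This is `(G^S)ᵀ diag(W_k) G^S` read blockwise. Block column `a` of `G^S` lives in rows `a` and
`a + 1` only, so columns `a` and `b` share a row only if `|a - b| ≤ 1`. -/
lemma triBlk_eq_sum (x : StateSeq N n) (a b : Fin N) :
    M.triBlk x a b = ∑ k, (M.GSblk x k a)ᵀ * M.weightW x k * M.GSblk x k b := by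
  have hz : ∀ k, (k ≠ a ∧ k.val ≠ a.val + 1) ∨ (k ≠ b ∧ k.val ≠ b.val + 1) →
      (M.GSblk x k a)ᵀ * M.weightW x k * M.GSblk x k b = 0 := by
    rintro k (h | h)
    · simp [M.GSblk_eq_zero x h.1 h.2]
    · simp [M.GSblk_eq_zero x h.1 h.2]
  unfold triBlk
  split_ifs with h1 h2 h3
  · subst h1
    unfold Ublk
    split_ifs with ha
    -- On the diagonal both rows `a` and `a + 1` contribute; at the last time row `a + 1` does not
    -- exist.
    · rw [Finset.sum_eq_add (⟨a.val + 1, ha⟩ : Fin N) a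
        (by simp [Fin.ext_iff]) (fun k _ hk => hz k (Or.inl ⟨hk.2, fun h => hk.1 (Fin.ext h)⟩))
        (by simp) (by simp), GSblk_self, GSblk_succ _ _ (by simp)]
      simp
    · rw [Finset.sum_eq_single a
        (fun k _ hk => hz k (Or.inl ⟨hk, fun h => ha (h ▸ k.isLt)⟩)) (by simp), GSblk_self]
      simp
  -- Off the diagonal the only shared row is the later of the two times.
  · rw [Finset.sum_eq_single a (fun k _ hk => hz k (by simp only [ne_eq, Fin.ext_iff] at *; omega))
      (by simp), GSblk_self, GSblk_succ _ _ h2]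
    simp [Ablk]
  · rw [Finset.sum_eq_single b (fun k _ hk => hz k (by simp only [ne_eq, Fin.ext_iff] at *; omega))
      (by simp), GSblk_self, GSblk_succ _ _ h3]
    simp [Ablk, transpose_mul, weightW_transpose]
  · exact (Finset.sum_eq_zero fun k _ => hz k (by simp only [ne_eq, Fin.ext_iff] at *; omega)).symm

/-- The block row `k` of `G^S x`, extended by zero to all components of the state sequence. -/
def procRow (x : StateSeq N n) (k : Fin N) : Matrix {i // i ∈ M.WS} (Fin N × Fin n) ℝ :=
  Matrix.of fun i q => if hq : q.2 ∈ M.WS then M.GSblk x k q.1 i ⟨q.2, hq⟩ else 0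

/-- The Jacobian of `h_k` restricted to the rows in `VS`, acting on the state sequence. -/
def measRow (x : StateSeq N n) (k : Fin N) : Matrix {i // i ∈ M.VS} (Fin N × Fin n) ℝ :=
  Matrix.of fun i q => if k = q.1 then M.hJacS k (block x k) i q.2 else 0

/-- Extending the rows by zero absorbs the placement on `WS`, so both parts of `U` become sums of
congruences of positive definite weights. -/
lemma U_eq_sum (x : StateSeq N n) :
    M.U x = ∑ k, ((M.procRow x k)ᵀ * M.weightW x k * M.procRow x k
      + (M.measRow x k)ᵀ * M.weightV x k * M.measRow x k) := by
  ext p q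
  rw [Finset.sum_add_distrib, Matrix.add_apply, Matrix.sum_apply, Matrix.sum_apply]
  simp only [U, of_apply]
  congr 1
  · split_ifs with hpq
    · rw [triBlk_eq_sum, Matrix.sum_apply]
      refine Finset.sum_congr rfl fun k _ => ?_
      simp [mul_apply, procRow, hpq.1, hpq.2]
    · symm
      refine Finset.sum_eq_zero fun k _ => ?_
      by_cases hp : p.2 ∈ M.WS
      · have hq : q.2 ∉ M.WS := fun hq => hpq ⟨hp, hq⟩
        simp [mul_apply, procRow, hq]
      · simp [mul_apply, procRow, hp]
  · rw [Finset.sum_eq_single p.1]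
    · split_ifs with h
      · simp [mul_apply, measRow, Hblk, h]
      · simp [mul_apply, measRow, h]
    · intro k _ hk
      simp [mul_apply, measRow, hk]
    · simp

lemma U_posSemidef (x : StateSeq N n) : (M.U x).PosSemidef := by
  rw [U_eq_sum]
  refine posSemidef_sum _ fun k _ => ?_
  have hW := (M.weightW_posDef x k).posSemidef.conjTranspose_mul_mul_same (M.procRow x k)
  have hV := (M.weightV_posDef x k).posSemidef.conjTranspose_mul_mul_same (M.measRow x k)
  simpa using hW.add hV

lemma sqNorm_U (x : StateSeq N n) (d : Fin N × Fin n → ℝ) :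
    sqNorm (M.U x) d = ∑ k, (sqNorm (M.weightW x k) (M.procRow x k *ᵥ d)
      + sqNorm (M.weightV x k) (M.measRow x k *ᵥ d)) := by
  simp only [U_eq_sum, sqNorm_sum, sqNorm_add, sqNorm_transpose_mul_mul]

/-- Every summand of `sqNorm_U` is nonnegative, so each vanishes, and definiteness of `weightW` does
the rest. -/
lemma procRow_mulVec_eq_zero {x : StateSeq N n} {d : Fin N × Fin n → ℝ}
    (h : sqNorm (M.U x) d = 0) (k : Fin N) : M.procRow x k *ᵥ d = 0 := by
  rw [sqNorm_U] at h
  have hW := fun k => sqNorm_nonneg (M.weightW_posDef x k).posSemidef (M.procRow x k *ᵥ d)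
  have hV := fun k => sqNorm_nonneg (M.weightV_posDef x k).posSemidef (M.measRow x k *ᵥ d)
  have hk := (Finset.sum_eq_zero_iff_of_nonneg fun k _ => add_nonneg (hW k) (hV k)).mp h k
    (Finset.mem_univ k)
  by_contra hne
  have := sqNorm_pos (M.weightW_posDef x k) hne
  linarith [hV k]

/-- If the preceding block of `d` vanishes, row `k` of `G^S x` applied to `d` is `d_k^S`. -/
lemma procRow_mulVec_apply (x : StateSeq N n) {d : StateSeq N n} {k : Fin N}
    (h : ∀ l : Fin N, k.val = l.val + 1 → block d l = 0) (i : {i // i ∈ M.WS}) :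
    (M.procRow x k *ᵥ d) i = d (k, i) := by
  rw [mulVec, dotProduct, Finset.sum_eq_single (k, i.1)]
  · simp [procRow, GSblk_self]
  · rintro ⟨l, j⟩ _ hlj
    by_cases hkl : k = l
    · subst hkl
      have hij : i.1 ≠ j := fun hij => hlj (by rw [hij])
      by_cases hj : j ∈ M.WS
      · simp [procRow, hj, GSblk_self, Subtype.ext_iff, hij]
      · simp [procRow, hj]
    · by_cases hs : k.val = l.val + 1
      · have : d (l, j) = 0 := congrArg (fun u : Euc (Fin n) => u j) (h l hs)
        simp [this]
      · simp [procRow, M.GSblk_eq_zero x hkl hs]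
  · simp

end Curvature

/-! ### Triviality of the kernel of `U` on the kernel of `F'` -/

section Kernel

variable {M}

/-- The Gaussian components of `w_k` are coordinates of `F`; the chain rule and uniqueness of
derivatives identify the two expressions. -/
lemma fderiv_w_apply_eq_zero (hg : ∀ k, ContDiff ℝ 2 (M.g k)) (hh : ∀ k, ContDiff ℝ 2 (M.h k))
    {x d : StateSeq N n} (hd : fderiv ℝ M.F x d = 0) (k : Fin N) {i : Fin n} (hi : i ∉ M.WS) :
    fderiv ℝ (fun y => M.w y k) x d i = 0 := by
  have hF : HasFDerivAt M.F (fderiv ℝ M.F x) x :=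
    ((contDiff_F hg hh).differentiable (by norm_num) x).hasFDerivAt
  have hw : HasFDerivAt (fun y => M.w y k) (fderiv ℝ (fun y => M.w y k) x) x :=
    ((contDiff_w hg k).differentiable (by norm_num) x).hasFDerivAt
  have h1 := (((EuclideanSpace.proj (𝕜 := ℝ) (Sum.inl (k, ⟨i, hi⟩) : M.GaussIdx)).comp
    (ContinuousLinearMap.snd ℝ ℝ (Euc M.GaussIdx))).hasFDerivAt (x := M.F x)).comp x hF
  have h2 := ((EuclideanSpace.proj (𝕜 := ℝ) i).hasFDerivAt (x := M.w x k)).comp x hw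
  have h3 := congrArg (fun L => L d) (h2.unique h1)
  simpa [hd] using h3

/-- Only `x_k` and `x_{k-1}` enter `w_k`, the former through the identity. At the first time the
condition on `d` is vacuous. -/
lemma fderiv_w_apply_eq_block (hg : ∀ k, ContDiff ℝ 2 (M.g k)) (x : StateSeq N n)
    {d : StateSeq N n} {k : Fin N} (h : ∀ l : Fin N, k.val = l.val + 1 → block d l = 0) :
    fderiv ℝ (fun y => M.w y k) x d = block d k := by
  have hb : ∀ l : Fin N, HasFDerivAt (fun y : StateSeq N n => block y l) (blockL l) x :=
    fun l => (blockL l).hasFDerivAt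
  unfold w predicted
  split_ifs with hk
  · rw [((hb k).sub_const M.g0).fderiv, blockL_apply]
  · have hgk := ((hg k).differentiable (by norm_num)
      (block x ⟨k.val - 1, lt_of_le_of_lt (Nat.sub_le _ _) k.isLt⟩)).hasFDerivAt
    refine (congrArg (fun L => L d) ((hb k).sub (hgk.comp x (hb _))).fderiv).trans ?_
    have := h ⟨k.val - 1, lt_of_le_of_lt (Nat.sub_le _ _) k.isLt⟩ (by simp; omega)
    simp [this]

/-- Forward induction in time: `U` kills the components of `d_k` in `WS`, and `F'` the others. -/
lemma eq_zero_of_sqNorm_U_eq_zero (hg : ∀ k, ContDiff ℝ 2 (M.g k))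
    (hh : ∀ k, ContDiff ℝ 2 (M.h k)) {x d : StateSeq N n} (hd : fderiv ℝ M.F x d = 0)
    (hU : sqNorm (M.U x) d = 0) : d = 0 := by
  have key : ∀ (j : ℕ) (k : Fin N), k.val = j → block d k = 0 := by
    intro j
    induction j using Nat.strong_induction_on with
    | _ j ih =>
      intro k hk
      have h : ∀ l : Fin N, k.val = l.val + 1 → block d l = 0 :=
        fun l hl => ih l.val (by omega) l rfl
      ext i
      by_cases hi : i ∈ M.WS
      · exact (M.procRow_mulVec_apply x h ⟨i, hi⟩).symm.trans
          (congrFun (M.procRow_mulVec_eq_zero hU k) _)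
      · rw [← fderiv_w_apply_eq_block hg x h, fderiv_w_apply_eq_zero hg hh hd k hi]
        rfl
  ext p
  exact congrArg (fun u : Euc (Fin n) => u p.2) (key _ p.1 rfl)

end Kernel

end Smoother

/-! ### Norm bounds and uniform positivity on compact sets -/

lemma norm_le_of_forall_abs_le {ι : Type} [Fintype ι] {u : Euc ι} {B : ℝ}
    (h : ∀ i, |u i| ≤ B) : ‖u‖ ≤ √(∑ _ : ι, B ^ 2) := by
  rw [EuclideanSpace.norm_eq]
  refine Real.sqrt_le_sqrt (Finset.sum_le_sum fun i _ => ?_)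
  exact pow_le_pow_left₀ (norm_nonneg _) (h i) 2

lemma exists_norm_le_of_sqNorm_le {ι : Type} [Fintype ι] {A : Matrix ι ι ℝ} (hA : A.PosDef)
    (C : ℝ) : ∃ B : ℝ, ∀ u : ι → ℝ, sqNorm A u ≤ C → ‖u‖ ≤ B := by
  obtain ⟨c, hc, h⟩ := exists_pos_mul_sq_norm_le_sqNorm hA
  refine ⟨√(C / c), fun u hu => Real.le_sqrt_of_sq_le ?_⟩
  rw [le_div_iff₀ hc, mul_comm]
  exact (h u).trans hu

/-- The subtype is then a reindexing of `ι`, and inversion commutes with reindexing. -/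
lemma sqNorm_inv_submatrix_val {ι : Type} [Fintype ι] [DecidableEq ι] {p : ι → Prop}
    [Fintype {i // p i}] (h : ∀ i, p i) (A : Matrix ι ι ℝ) (u : ι → ℝ) :
    sqNorm (A.submatrix (Subtype.val : {i // p i} → ι) Subtype.val)⁻¹ (fun i => u i)
      = sqNorm A⁻¹ u := by
  rw [← sqNorm_submatrix_equiv (Equiv.subtypeUnivEquiv h) A⁻¹ u, ← inv_submatrix_equiv]
  rfl

/-- A family of quadratic forms `q x` that is positive on the kernels of `L x` is uniformly positive
there as `x` runs through a compact set. -/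
lemma exists_pos_mul_sq_norm_le {X E Y : Type*} [TopologicalSpace X] [NormedAddCommGroup E]
    [NormedSpace ℝ E] [FiniteDimensional ℝ E] [NormedAddCommGroup Y] [NormedSpace ℝ Y]
    {S : Set X} (hS : IsCompact S) {L : X → E →L[ℝ] Y} (hL : Continuous L)
    {q : X → E → ℝ} (hq : Continuous fun p : X × E => q p.1 p.2)
    (hsmul : ∀ x (c : ℝ) d, q x (c • d) = c ^ 2 * q x d)
    (hpos : ∀ x ∈ S, ∀ d, L x d = 0 → d ≠ 0 → 0 < q x d) :
    ∃ lam : ℝ, 0 < lam ∧ ∀ x ∈ S, ∀ d, L x d = 0 → lam * ‖d‖ ^ 2 ≤ q x d := by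
  have hzero : ∀ x, q x 0 = 0 := fun x => by simpa using hsmul x 0 0
  -- The pairs of a point of `S` and a unit kernel vector form a compact set; the minimum of `q`
  -- there is the constant, and homogeneity gives the rest.
  have hcomp : IsCompact ((S ×ˢ Metric.sphere (0 : E) 1) ∩ {p : X × E | L p.1 p.2 = 0}) :=
    (hS.prod (isCompact_sphere 0 1)).inter_right
      (isClosed_eq ((hL.comp continuous_fst).clm_apply continuous_snd) continuous_const)
  have hmem : ∀ x ∈ S, ∀ d, L x d = 0 → d ≠ 0 →
      (x, ‖d‖⁻¹ • d) ∈ (S ×ˢ Metric.sphere (0 : E) 1) ∩ {p : X × E | L p.1 p.2 = 0} := by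
    intro x hx d hd hd0
    refine ⟨⟨hx, ?_⟩, ?_⟩
    · simp [norm_smul, norm_ne_zero_iff.mpr hd0]
    · simp [hd]
  obtain ⟨lam, hlam, hle⟩ : ∃ lam : ℝ, 0 < lam ∧
      ∀ p ∈ (S ×ˢ Metric.sphere (0 : E) 1) ∩ {p : X × E | L p.1 p.2 = 0}, lam ≤ q p.1 p.2 := by
    rcases ((S ×ˢ Metric.sphere (0 : E) 1) ∩ {p : X × E | L p.1 p.2 = 0}).eq_empty_or_nonempty
      with h | h
    · exact ⟨1, one_pos, by simp [h]⟩
    · obtain ⟨p, hp, hmin⟩ := hcomp.exists_isMinOn h hq.continuousOn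
      refine ⟨q p.1 p.2, hpos p.1 hp.1.1 p.2 hp.2 ?_, fun p' hp' => hmin hp'⟩
      intro h0
      have := hp.1.2
      simp [h0] at this
  refine ⟨lam, hlam, fun x hx d hd => ?_⟩
  by_cases hd0 : d = 0
  · simp [hd0, hzero]
  have hn : ‖d‖ ≠ 0 := norm_ne_zero_iff.mpr hd0
  have h1 := hle _ (hmem x hx d hd hd0)
  simp only [hsmul] at h1
  calc lam * ‖d‖ ^ 2 ≤ (‖d‖⁻¹ ^ 2 * q x d) * ‖d‖ ^ 2 := by gcongr
    _ = q x d := by field_simp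

namespace Smoother

variable {N n m : ℕ} (M : Smoother N n m)

lemma gaussSq_F (x : StateSeq N n) :
    M.gaussSq (M.F x).2 = ∑ k, sqNorm (M.QG k)⁻¹ (M.wG x k)
      + ∑ k, sqNorm (M.RG k)⁻¹ (M.vG x k) := rfl

/-! ### Compactness of the level set and uniform positivity of `U` -/

section LevelSet

/-- The finite value of the objective `K`. -/
def objReal (x : StateSeq N n) : ℝ := M.f x + 1 / 2 * M.gaussSq (M.F x).2

lemma preimage_Lam (x0 : StateSeq N n) :
    M.F ⁻¹' M.Lam x0 = {x | M.objReal x ≤ M.objReal x0} := by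
  ext x
  change M.K x ≤ M.K x0 ↔ M.objReal x ≤ M.objReal x0
  rw [K_eq, K_eq, EReal.coe_le_coe_iff]
  rfl

lemma sqNorm_wG_le (x : StateSeq N n) (k : Fin N) :
    sqNorm (M.QG k)⁻¹ (M.wG x k) ≤ 2 * M.objReal x := by
  have h1 : sqNorm (M.QG k)⁻¹ (M.wG x k) ≤ ∑ k, sqNorm (M.QG k)⁻¹ (M.wG x k) :=
    Finset.single_le_sum (f := fun k => sqNorm (M.QG k)⁻¹ (M.wG x k))
      (fun k _ => sqNorm_nonneg (M.QG_posDef k).inv.posSemidef _) (Finset.mem_univ k)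
  have h2 : 0 ≤ ∑ k, sqNorm (M.RG k)⁻¹ (M.vG x k) :=
    Finset.sum_nonneg fun k _ => sqNorm_nonneg (M.RG_posDef k).inv.posSemidef _
  have h3 := M.f_nonneg x
  have h4 := M.gaussSq_F x
  unfold objReal
  linarith

/-- All other terms of the objective are nonnegative, so one logarithmic term is at most `2 *
M.objReal x`, the factor cancelling the `1 / 2`. -/
lemma sqNorm_wS_le (x : StateSeq N n) (k : Fin N) :
    sqNorm (M.QS k)⁻¹ (M.wS x k) ≤ M.r k * Real.exp (2 * M.objReal x / M.r k) := by
  refine le_of_mul_log_one_add_div_le (M.sqNorm_wS_nonneg x k) (M.r_pos k) ?_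
  have hs := fun k => mul_log_one_add_div_nonneg (M.sqNorm_vS_nonneg x k) (M.s_pos k)
  have hr := fun k => mul_log_one_add_div_nonneg (M.sqNorm_wS_nonneg x k) (M.r_pos k)
  have h1 := Finset.single_le_sum (f := fun k =>
    M.s k * Real.log (1 + sqNorm (M.RS k)⁻¹ (M.vS x k) / M.s k)
      + M.r k * Real.log (1 + sqNorm (M.QS k)⁻¹ (M.wS x k) / M.r k))
    (fun k _ => add_nonneg (hs k) (hr k)) (Finset.mem_univ k)
  have h2 : ∑ k, (M.s k * Real.log (1 + sqNorm (M.RS k)⁻¹ (M.vS x k) / M.s k)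
      + M.r k * Real.log (1 + sqNorm (M.QS k)⁻¹ (M.wS x k) / M.r k)) = 2 * M.f x := by
    rw [f]; ring
  have h3 := M.gaussSq_nonneg (M.F x).2
  have h4 := hs k
  simp only [objReal]
  rw [h2] at h1
  linarith

lemma exists_norm_w_le (c : ℝ) (k : Fin N) :
    ∃ B : ℝ, ∀ x, M.objReal x ≤ c → ‖M.w x k‖ ≤ B := by
  obtain ⟨BS, hS⟩ := exists_norm_le_of_sqNorm_le (M.QS_posDef k).inv
    (M.r k * Real.exp (2 * c / M.r k))
  obtain ⟨BG, hG⟩ := exists_norm_le_of_sqNorm_le (M.QG_posDef k).inv (2 * c)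
  refine ⟨_, fun x hx => norm_le_of_forall_abs_le (B := max BS BG) fun i => ?_⟩
  have hr := M.r_pos k
  by_cases hi : i ∈ M.WS
  · refine le_trans ?_ (le_max_left _ _)
    exact (norm_le_pi_norm (M.wS x k) ⟨i, hi⟩).trans
      (hS _ ((M.sqNorm_wS_le x k).trans (by gcongr)))
  · refine le_trans ?_ (le_max_right _ _)
    exact (norm_le_pi_norm (M.wG x k) ⟨i, hi⟩).trans
      (hG _ ((M.sqNorm_wG_le x k).trans (by gcongr)))

variable {M}

/-- Forward recursion in time: a bound on `x_{k-1}` bounds `g_k (x_{k-1})` by continuity on a closed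
ball, and `w_k` is already controlled. -/
lemma exists_norm_block_le (hg : ∀ k, ContDiff ℝ 2 (M.g k)) (c : ℝ) (k : Fin N) :
    ∃ B : ℝ, ∀ x, M.objReal x ≤ c → ‖block x k‖ ≤ B := by
  have key : ∀ (j : ℕ) (k : Fin N), k.val = j →
      ∃ B : ℝ, ∀ x, M.objReal x ≤ c → ‖block x k‖ ≤ B := by
    intro j
    induction j using Nat.strong_induction_on with
    | _ j ih =>
      intro k hk
      obtain ⟨B, hB⟩ := M.exists_norm_w_le c k
      obtain ⟨B', hB'⟩ : ∃ B' : ℝ, ∀ x, M.objReal x ≤ c → ‖M.predicted x k‖ ≤ B' := by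
        unfold predicted
        split_ifs with h0
        · exact ⟨‖M.g0‖, fun _ _ => le_rfl⟩
        · obtain ⟨B₁, hB₁⟩ := ih (k.val - 1) (by omega)
            ⟨k.val - 1, lt_of_le_of_lt (Nat.sub_le _ _) k.isLt⟩ rfl
          obtain ⟨B₂, hB₂⟩ :=
            (isCompact_closedBall (0 : Euc (Fin n)) B₁).exists_bound_of_continuousOn
              (hg k).continuous.continuousOn
          exact ⟨B₂, fun x hx => hB₂ _ (by simpa using hB₁ x hx)⟩
      refine ⟨B + B', fun x hx => ?_⟩
      have : block x k = M.w x k + M.predicted x k := by simp [w]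
      rw [this]
      exact (norm_add_le _ _).trans (add_le_add (hB x hx) (hB' x hx))
  exact key _ k rfl

lemma isCompact_preimage_Lam (hg : ∀ k, ContDiff ℝ 2 (M.g k)) (hh : ∀ k, ContDiff ℝ 2 (M.h k))
    (x0 : StateSeq N n) : IsCompact (M.F ⁻¹' M.Lam x0) := by
  rw [preimage_Lam]
  have hcont : Continuous M.objReal := by
    refine (contDiff_f hg hh).continuous.add (continuous_const.mul ?_)
    simp only [gaussSq_F]
    refine Continuous.add ?_ ?_ <;> refine continuous_finsetSum _ fun k _ => ?_
    · exact (contDiff_sqNorm (p := 2) _ fun i : {i // i ∉ M.WS} =>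
        contDiff_euclidean.mp (contDiff_w hg k) i.1).continuous
    · exact (contDiff_sqNorm (p := 2) _ fun i : {i // i ∉ M.VS} =>
        contDiff_euclidean.mp (contDiff_v hh k) i.1).continuous
  refine Metric.isCompact_of_isClosed_isBounded (isClosed_le hcont continuous_const) ?_
  choose B hB using exists_norm_block_le hg (M.objReal x0)
  -- The sum of the `|B k|` bounds all blocks at once and also makes sense for `N = 0`.
  refine isBounded_iff_forall_norm_le.mpr
    ⟨_, fun x hx => norm_le_of_forall_abs_le (B := ∑ k, |B k|) fun p => ?_⟩
  calc |x p| ≤ ‖block x p.1‖ := PiLp.norm_apply_le (block x p.1) p.2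
    _ ≤ |B p.1| := (hB p.1 x hx).trans (le_abs_self _)
    _ ≤ ∑ k, |B k| :=
      Finset.single_le_sum (f := fun k => |B k|) (fun _ _ => abs_nonneg _) (Finset.mem_univ _)

/-- In finite dimension the closed hull of a bounded set is compact, and so is its sum with a
compact ball. -/
lemma isCompact_S0 (hg : ∀ k, ContDiff ℝ 2 (M.g k)) (hh : ∀ k, ContDiff ℝ 2 (M.h k))
    (x0 : StateSeq N n) (τ : ℝ) : IsCompact (M.S0 x0 τ) := by
  have hb := (isBounded_convexHull.mpr (isCompact_preimage_Lam hg hh x0).isBounded).closure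
  exact (Metric.isCompact_of_isClosed_isBounded isClosed_closure hb).add
    ((isCompact_closedBall (0 : StateSeq N n) 1).smul τ)

lemma exists_pos_mul_sq_norm_le_sqNorm_U (hg : ∀ k, ContDiff ℝ 2 (M.g k))
    (hh : ∀ k, ContDiff ℝ 2 (M.h k)) (x0 : StateSeq N n) :
    ∃ lam : ℝ, 0 < lam ∧ ∀ x ∈ M.F ⁻¹' M.Lam x0, ∀ d : StateSeq N n,
      fderiv ℝ M.F x d = 0 → lam * ‖d‖ ^ 2 ≤ sqNorm (M.U x) d := by
  refine exists_pos_mul_sq_norm_le (q := fun x (d : StateSeq N n) => sqNorm (M.U x) d)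
    (isCompact_preimage_Lam hg hh x0) ((contDiff_F hg hh).continuous_fderiv (by norm_num)) ?_
    (fun x c d => sqNorm_smul_vec _ c _) ?_
  · exact continuous_sqNorm ((continuous_U hg hh).comp continuous_fst)
      ((PiLp.continuous_ofLp 2 _).comp continuous_snd)
  · intro x _ d hd hd0
    refine lt_of_le_of_ne (sqNorm_nonneg (M.U_posSemidef x) _) fun h => hd0 ?_
    exact eq_zero_of_sqNorm_U_eq_zero hg hh hd h.symm

end LevelSet

/-! ### The T-Robust, T-Trend and Double-T smoothers -/

section SpecialCases

variable {M}

lemma K_of_isTRobust (hM : M.IsTRobust) (x : StateSeq N n) :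
    M.K x = (M.objTRobust x : EReal) := by
  obtain ⟨hW, hV⟩ := hM
  have hW' : ∀ i, i ∉ M.WS := by simp [hW]
  have hV' : ∀ i, i ∈ M.VS := by simp [hV]
  have : IsEmpty {i // i ∈ M.WS} := ⟨fun i => hW' _ i.2⟩
  have : IsEmpty {i // i ∉ M.VS} := ⟨fun i => i.2 (hV' _)⟩
  have hQ : ∀ k, sqNorm (M.QG k)⁻¹ (M.wG x k) = sqNorm (M.Q k)⁻¹ (M.w x k) :=
    fun k => sqNorm_inv_submatrix_val hW' _ _
  have hR : ∀ k, sqNorm (M.RS k)⁻¹ (M.vS x k) = sqNorm (M.R k)⁻¹ (M.v x k) :=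
    fun k => sqNorm_inv_submatrix_val hV' _ _
  rw [K_eq, gaussSq_F, f, objTRobust]
  simp [hQ, hR, sqNorm_of_isEmpty, Finset.sum_add_distrib, mul_add]

lemma K_of_isTTrend (hM : M.IsTTrend) (x : StateSeq N n) :
    M.K x = (M.objTTrend x : EReal) := by
  obtain ⟨hW, hV⟩ := hM
  have hW' : ∀ i, i ∈ M.WS := by simp [hW]
  have hV' : ∀ i, i ∉ M.VS := by simp [hV]
  have : IsEmpty {i // i ∉ M.WS} := ⟨fun i => i.2 (hW' _)⟩
  have : IsEmpty {i // i ∈ M.VS} := ⟨fun i => hV' _ i.2⟩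
  have hQ : ∀ k, sqNorm (M.QS k)⁻¹ (M.wS x k) = sqNorm (M.Q k)⁻¹ (M.w x k) :=
    fun k => sqNorm_inv_submatrix_val hW' _ _
  have hR : ∀ k, sqNorm (M.RG k)⁻¹ (M.vG x k) = sqNorm (M.R k)⁻¹ (M.v x k) :=
    fun k => sqNorm_inv_submatrix_val hV' _ _
  rw [K_eq, gaussSq_F, f, objTTrend]
  simp [hQ, hR, sqNorm_of_isEmpty, Finset.sum_add_distrib, mul_add]

lemma K_of_isDoubleT (hM : M.IsDoubleT) (x : StateSeq N n) :
    M.K x = (M.objDoubleT x : EReal) := by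
  obtain ⟨hW, hV⟩ := hM
  have hW' : ∀ i, i ∈ M.WS := by simp [hW]
  have hV' : ∀ i, i ∈ M.VS := by simp [hV]
  have : IsEmpty {i // i ∉ M.WS} := ⟨fun i => i.2 (hW' _)⟩
  have : IsEmpty {i // i ∉ M.VS} := ⟨fun i => i.2 (hV' _)⟩
  have hQ : ∀ k, sqNorm (M.QS k)⁻¹ (M.wS x k) = sqNorm (M.Q k)⁻¹ (M.w x k) :=
    fun k => sqNorm_inv_submatrix_val hW' _ _
  have hR : ∀ k, sqNorm (M.RS k)⁻¹ (M.vS x k) = sqNorm (M.R k)⁻¹ (M.v x k) :=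
    fun k => sqNorm_inv_submatrix_val hV' _ _
  rw [K_eq, gaussSq_F, f, objDoubleT]
  simp [hQ, hR, sqNorm_of_isEmpty, add_comm]

end SpecialCases

end Smoother

end

theorem mainTheorem3 {N n m : ℕ} (M : Smoother N n m)
    (hg : ∀ k, ContDiff ℝ 2 (M.g k)) (hh : ∀ k, ContDiff ℝ 2 (M.h k))
    (x0 : StateSeq N n) :
    -- the standing assumptions of the convergence theory: `ρ` is convex, `F` is smooth,
    -- `U` is continuous with symmetric positive semidefinite values
    (Convex ℝ {p : M.Target × ℝ | M.rho p.1 ≤ (p.2 : EReal)} ∧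
      ContDiff ℝ 2 M.F ∧ Continuous M.U ∧ ∀ x, (M.U x).PosSemidef) ∧
    -- the derivative of `F` is bounded and uniformly continuous on `S₀`
    (∀ τ : ℝ, 0 < τ →
      (∃ C : ℝ, ∀ x ∈ M.S0 x0 τ, ‖fderiv ℝ M.F x‖ ≤ C) ∧
      UniformContinuousOn (fderiv ℝ M.F) (M.S0 x0 τ)) ∧
    -- the hypotheses of the stronger convergence result
    ((∀ x ∈ M.F ⁻¹' M.Lam x0, ∃ η : ℝ, 0 < η ∧ (η : EReal) < sigmaMin (M.GS x)) →
      Bornology.IsBounded (M.F ⁻¹' M.Lam x0) ∧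
      ∃ lam : ℝ, 0 < lam ∧ ∀ x ∈ M.F ⁻¹' M.Lam x0, ∀ d : StateSeq N n,
        fderiv ℝ M.F x d = 0 → lam * ‖d‖ ^ 2 ≤ sqNorm (M.U x) d) ∧
    -- the framework contains the three smoothers
    (M.IsTRobust → ∀ x, M.K x = (M.objTRobust x : EReal)) ∧
    (M.IsTTrend → ∀ x, M.K x = (M.objTTrend x : EReal)) ∧
    (M.IsDoubleT → ∀ x, M.K x = (M.objDoubleT x : EReal)) := by
  have hF := Smoother.contDiff_F hg hh
  have hF' := hF.continuous_fderiv (by norm_num)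
  refine ⟨⟨M.convex_epigraph_rho, hF, Smoother.continuous_U hg hh, M.U_posSemidef⟩, fun τ _ => ⟨?_, ?_⟩,
    fun _ => ⟨(Smoother.isCompact_preimage_Lam hg hh x0).isBounded,
      Smoother.exists_pos_mul_sq_norm_le_sqNorm_U hg hh x0⟩,
    Smoother.K_of_isTRobust, Smoother.K_of_isTTrend, Smoother.K_of_isDoubleT⟩
  · exact (Smoother.isCompact_S0 hg hh x0 τ).exists_bound_of_continuousOn hF'.continuousOn
  · exact (Smoother.isCompact_S0 hg hh x0 τ).uniformContinuousOn_of_continuous hF'.continuousOn
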